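/- Let $A$ be a commutative ring, let $\mathcal F$ be its total ring of fractions, and let $Z$ be a prime ideal of $A$ that contains all zerodivisors of $A$. Let $m,n\ge 0$ be integers and let $P\in\mathcal F^{n\times m}$ be a causal plant, that is, every entry of $P$ is of the form $a/d$ with $a\in A$ and $d\in A\setminus Z$. The plant $P$ is called *stabilizable* if there is a matrix $C\in\mathcal F^{m\times n}$ such that $\det(E_n+PC)$ is a unit of $\mathcal F$ and all entries of $$H(P,C)=\begin{bmatrix}(E_n+PC)^{-1} & -P(E_m+CP)^{-1}\\ C(E_n+PC)^{-1} & (E_m+CP)^{-1}\end{bmatrix}$$ lie in $A$, where $E_k$ denotes the $k\times k$ identity matrix. Then there are matrices $N,\tilde N\in A^{n\times m}$, $D\in A^{m\times m}$ and $\tilde D\in A^{n\times n}$ such that $\det D$ and $\det\tilde D$ are nonzerodivisors of $A$ and $P=ND^{-1}=\tilde D^{-1}\tilde N$ over $\mathcal F$. For every choice of such matrices put $T=\begin{bmatrix}N\\ D\end{bmatrix}\in A^{(m+n)\times m}$, let $\mathcal T_P$ be the $A$-module generated by the rows of $T$, and let $\mathcal W_P$ be the $A$-module generated by the columns of $[\tilde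 N\ \ \tilde D]$. For a subset $I=\{i_1<\dots<i_m\}$ of $\{1,\dots,m+n\}$ with $m$ elements, let $\Delta_I\in A^{m\times(m+n)}$ be the matrix with entries $1$ at the positions $(k,i_k)$ and $0$ elsewhere, and let $$\Lambda_{P,I}=\{\lambda\in A \mid \lambda T=K\Delta_I T\ \text{for some } K\in A^{(m+n)\times m}\},$$ which is an ideal of $A$. Then the following statements are equivalent: 1. $P$ is stabilizable; 2. the $A$-modules $\mathcal T_P$ and $\mathcal W_P$ are projective; 3. $\sum_I\Lambda_{P,I}=A$, where $I$ runs over all $m$-element subsets of $\{1,\dots,m+n\}$. -/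

import Mathlib

namespace FeedbackStabilization

section Causality

variable {A : Type*} [CommRing A]

/-- The transfer functions `a / d` in `F` with `a ∈ A` and `d ∈ A ∖ Z`. When all zerodivisors of `A`
lie in `Z` such a `d` is a nonzerodivisor, so that `x = a / d` in the total ring of fractions `F`
says exactly `x * d = a`. -/
def causalFunctions (Z : Ideal A) (F : Type*) [CommRing F] [Algebra A F] : Set F :=
  {x | ∃ a d : A, d ∉ Z ∧ x * algebraMap A F d = algebraMap A F a}

/-- A transfer matrix is causal if all its entries are. -/
def IsCausal {ι κ F : Type*} [CommRing F] [Algebra A F] (Z : Ideal A) (P : Matrix ι κ F) : Prop :=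
  ∀ i j, P i j ∈ causalFunctions Z F

end Causality

section Stabilization

variable {F : Type*} [CommRing F] {n m : ℕ}

/-- The transfer matrix `H(P, C)` from `(u₁, u₂)` to `(e₁, e₂)` of the feedback system. It is
used only when `det (1 + P C)`, which equals `det (1 + C P)`, is a unit of `F`. -/
noncomputable def feedbackMatrix (P : Matrix (Fin n) (Fin m) F) (C : Matrix (Fin m) (Fin n) F) :
    Matrix (Fin n ⊕ Fin m) (Fin n ⊕ Fin m) F :=
  Matrix.fromBlocks ((1 + P * C)⁻¹) (-(P * (1 + C * P)⁻¹))
    (C * (1 + P * C)⁻¹) ((1 + C * P)⁻¹)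

variable (A : Type*) [CommRing A] [Algebra A F]

/-- `C` is a stabilizing controller of `P`: the closed loop is well posed and the entries of
`H(P, C)` lie in (the image of) the ring `A` of stable causal transfer functions. -/
def IsStabilizingController (P : Matrix (Fin n) (Fin m) F) (C : Matrix (Fin m) (Fin n) F) : Prop :=
  IsUnit (1 + P * C).det ∧ ∀ i j, feedbackMatrix P C i j ∈ Set.range (algebraMap A F)

/-- The plant `P` has a stabilizing controller (with entries in `F`, not required to be causal). -/
def IsStabilizable (P : Matrix (Fin n) (Fin m) F) : Prop :=
  ∃ C : Matrix (Fin m) (Fin n) F, IsStabilizingController A P C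

end Stabilization

section Fractions

variable {A F : Type*} [CommRing A] [CommRing F] [Algebra A F] {n m : ℕ}

/-- `P = N D⁻¹` over `F`, with `N`, `D` over `A` and `det D` a nonzerodivisor. -/
def IsRightFraction (P : Matrix (Fin n) (Fin m) F)
    (N : Matrix (Fin n) (Fin m) A) (D : Matrix (Fin m) (Fin m) A) : Prop :=
  D.det ∈ nonZeroDivisors A ∧ P = N.map (algebraMap A F) * (D.map (algebraMap A F))⁻¹

/-- `P = D'⁻¹ N'` over `F`, with `N'`, `D'` over `A` and `det D'` a nonzerodivisor. -/
def IsLeftFraction (P : Matrix (Fin n) (Fin m) F)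
    (N' : Matrix (Fin n) (Fin m) A) (D' : Matrix (Fin n) (Fin n) A) : Prop :=
  D'.det ∈ nonZeroDivisors A ∧ P = (D'.map (algebraMap A F))⁻¹ * N'.map (algebraMap A F)

end Fractions

section Modules

variable {A : Type*} [CommRing A]

/-- The `A`-module generated by the rows of a matrix. -/
def rowModule {ι κ : Type*} (M : Matrix ι κ A) : Submodule A (κ → A) :=
  Submodule.span A (Set.range fun i => M i)

/-- The `A`-module generated by the columns of a matrix. -/
def colModule {ι κ : Type*} (M : Matrix ι κ A) : Submodule A (ι → A) :=
  Submodule.span A (Set.range fun j i => M i j)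

variable {n m : ℕ}

/-- The matrix `T = [N; D]`, with the rows of `N` above those of `D`, rows numbered by
`Fin (n + m)`. -/
def rowStack (N : Matrix (Fin n) (Fin m) A) (D : Matrix (Fin m) (Fin m) A) :
    Matrix (Fin (n + m)) (Fin m) A :=
  (Matrix.fromRows N D).submatrix finSumFinEquiv.symm id

/-- The selection matrix `Δ_I`: if `i₁ < ⋯ < i_m` are the elements of `I`, its `(k, i_k)`-entries
are `1` and all other entries are `0`. -/
def selectionMatrix (A : Type*) [CommRing A] {n m : ℕ} (I : Finset (Fin (n + m)))
    (hI : I.card = m) : Matrix (Fin m) (Fin (n + m)) A :=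
  Matrix.of fun k j => if j = I.orderEmbOfFin hI k then 1 else 0

/-- The generalized elementary factor
`Λ_I = {l ∈ A | l T = K Δ_I T for some (m+n) × m matrix K over A}`, where `T = [N; D]`. -/
def generalizedElementaryFactor (N : Matrix (Fin n) (Fin m) A) (D : Matrix (Fin m) (Fin m) A)
    (I : Finset (Fin (n + m))) (hI : I.card = m) : Ideal A where
  carrier := {l | ∃ K : Matrix (Fin (n + m)) (Fin m) A,
    l • rowStack N D = K * selectionMatrix A I hI * rowStack N D}
  zero_mem' := ⟨0, by simp⟩
  add_mem' := by
    rintro a b ⟨K, hK⟩ ⟨L, hL⟩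
    exact ⟨K + L, by rw [add_smul, hK, hL, Matrix.add_mul, Matrix.add_mul]⟩
  smul_mem' := by
    rintro c a ⟨K, hK⟩
    exact ⟨c • K, by rw [smul_eq_mul, mul_smul, hK, Matrix.smul_mul, Matrix.smul_mul]⟩

end Modules

end FeedbackStabilization

/-! All three conditions are compared with a splitting: matrices `S₁`, `S₂` over `A` with `S₁ P + S₂
= 1` and `P S₁`, `P S₂` over `A`, so that `E = [P; 1] [S₁ S₂]` is an idempotent over `A`.

A stabilizing `C` yields `[S₁ S₂] = (1 + C P)⁻¹ [C 1]`, up to signs and a `1` read off from `H(P,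
C)`. Conversely `C = S₂⁻¹ S₁` stabilizes once `S₂` is invertible over `F`; causality of `P` allows
the splitting to be perturbed until `det S₂ ∉ Z` (`exists_det_add_smul_mul_notMem`).

As `T = [P; 1] D`, `E` exhibits the row module as a summand of a free module, and the complementary
idempotent does so for the column module. Conversely a section of `A^(m+n) → 𝒯_P` is a splitting
(`hasSplitting_of_projective`).

For the ideals, `det (1 + X E) = (1 + X)^m` shows that the principal `m`-minors of `E` sum to `1`,
and the minor on `I` lies in `Λ_I`. Conversely each `Λ_I` lies in the radical of `splittingIdeal`,
so if they generate `A`, the row module is projective. -/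

namespace FeedbackStabilization

/-! ### Projectivity of row modules -/

section RowModules

variable {A : Type*} [CommRing A] {ι κ : Type*}

theorem rowModule_eq_range [Fintype ι] (M : Matrix ι κ A) :
    rowModule M = LinearMap.range M.vecMulLinear :=
  (range_vecMulLinear M).symm

/-- The row module of `M` is projective iff the canonical surjection onto it from the free module
on the rows splits; the splitting composed with the surjection is given by the matrix `G`. -/
theorem projective_rowModule_iff [Fintype ι] [DecidableEq ι] (M : Matrix ι κ A) :
    Module.Projective A (rowModule M) ↔
      ∃ G : Matrix ι ι A, G * M = M ∧ ∀ x, Matrix.vecMul x M = 0 → Matrix.vecMul x G = 0 := by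
  rw [rowModule_eq_range]
  constructor
  · intro h
    obtain ⟨s, hs⟩ := LinearMap.exists_rightInverse_of_surjective M.vecMulLinear.rangeRestrict
      (LinearMap.range_rangeRestrict _)
    let g : (ι → A) →ₗ[A] (ι → A) := s ∘ₗ M.vecMulLinear.rangeRestrict
    have hg : ∀ x, Matrix.vecMul x (LinearMap.toMatrix' g).transpose = g x := by
      intro x
      rw [Matrix.vecMul_transpose, LinearMap.toMatrix'_mulVec]
    have hgM : ∀ x, Matrix.vecMul (g x) M = Matrix.vecMul x M := fun x =>
      congrArg Subtype.val (LinearMap.congr_fun hs (M.vecMulLinear.rangeRestrict x))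
    refine ⟨(LinearMap.toMatrix' g).transpose, ?_, fun x hx => ?_⟩
    · refine Matrix.ext_of_single_vecMul fun i => ?_
      rw [← Matrix.vecMul_vecMul, hg, hgM]
    · rw [hg]
      have : M.vecMulLinear.rangeRestrict x = 0 := Subtype.ext hx
      rw [LinearMap.comp_apply, this, map_zero]
  · rintro ⟨G, hG, hker⟩
    -- The kernel condition lets `x ↦ x G` descend to the row module, where it is the section.
    have hle : LinearMap.ker M.vecMulLinear ≤ LinearMap.ker G.vecMulLinear :=
      fun x hx => hker x hx
    let s : LinearMap.range M.vecMulLinear →ₗ[A] (ι → A) :=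
      (LinearMap.ker M.vecMulLinear).liftQ G.vecMulLinear hle ∘ₗ
        M.vecMulLinear.quotKerEquivRange.symm.toLinearMap
    refine Module.Projective.of_split s M.vecMulLinear.rangeRestrict (LinearMap.ext ?_)
    rintro ⟨_, x, rfl⟩
    refine Subtype.ext ?_
    have : s ⟨M.vecMulLinear x, x, rfl⟩ = Matrix.vecMul x G := by
      have hx := M.vecMulLinear.quotKerEquivRange_symm_apply_image x ⟨x, rfl⟩
      simp only [s, LinearMap.comp_apply, LinearEquiv.coe_coe]
      exact (congrArg _ hx).trans (Submodule.liftQ_apply _ _ _)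
    rw [LinearMap.comp_apply, this]
    change Matrix.vecMul (Matrix.vecMul x G) M = Matrix.vecMul x M
    rw [Matrix.vecMul_vecMul, hG]

theorem rowModule_submatrix_equiv {ι' : Type*} (M : Matrix ι κ A) (e : ι' ≃ ι) :
    rowModule (M.submatrix e id) = rowModule M := by
  unfold rowModule
  congr 1
  exact e.surjective.range_comp fun i => M i

end RowModules

/-! ### Determinantal identities -/

section Minors

variable {R : Type*} [CommRing R] {ι κ : Type*} [Fintype κ] [DecidableEq κ]

/-- The square block of `M S` is a product of square matrices, so its adjugate splits and each
factor cancels. This later supplies the `K` that puts a principal minor into `Λ_I`. -/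
theorem mul_submatrix_mul_adjugate_mul_submatrix (M : Matrix ι κ R) (S : Matrix κ ι R)
    (o : κ → ι) :
    (M * S).submatrix id o * ((M * S).submatrix o o).adjugate * M.submatrix o id =
      ((M * S).submatrix o o).det • M := by
  have h1 : (M * S).submatrix o o = M.submatrix o id * S.submatrix id o := rfl
  have h2 : (M * S).submatrix id o = M * S.submatrix id o := rfl
  rw [h1, h2, Matrix.adjugate_mul_distrib, Matrix.det_mul]
  calc M * S.submatrix id o * ((S.submatrix id o).adjugate * (M.submatrix o id).adjugate) *
        M.submatrix o id
      = M * (S.submatrix id o * (S.submatrix id o).adjugate) *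
          ((M.submatrix o id).adjugate * M.submatrix o id) := by
        simp only [Matrix.mul_assoc]
    _ = _ := by
        rw [Matrix.mul_adjugate, Matrix.adjugate_mul]
        simp [smul_smul]

/-- If `S M = 1` then the principal minors of `M S` of the size of `S M` sum up to `1`. -/
theorem sum_minors_eq_one [Fintype ι] [DecidableEq ι] (M : Matrix ι κ R) (S : Matrix κ ι R)
    (h : S * M = 1) :
    ∑ s ∈ Finset.univ.powersetCard (Fintype.card κ),
      ((M * S).submatrix (Subtype.val : s → ι) (Subtype.val : s → ι)).det = 1 := by
  open Polynomial in
  -- The sum is a coefficient of `det (1 + X M S) = det (1 + X S M) = (1 + X)^|κ|`, namely the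
  -- leading one.
  rw [← Matrix.coeff_det_one_add_X_smul_eq_sum_minors, Matrix.map_mul, ← Matrix.smul_mul,
    Matrix.det_one_add_mul_comm, Matrix.mul_smul, ← Matrix.map_mul, h,
    Matrix.map_one C (map_zero C) (map_one C)]
  have : (1 + (X : R[X]) • (1 : Matrix κ κ R[X])) = (X + C 1 : R[X]) • 1 := by
    rw [add_smul, map_one, one_smul, add_comm]
  rw [this, Matrix.det_smul, Matrix.det_one, mul_one, coeff_X_add_C_pow]
  simp

/-- If `l T` factors as `K` times the rows of `T` chosen by `o`, and some other choice `o'` of rows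
has a nonzerodivisor as determinant, then `K` respects the relations between the rows of `T` up to
a power of `l`. -/
theorem pow_smul_vecMul_eq_zero [Fintype ι] {T : Matrix ι κ R} {K : Matrix ι κ R} {l : R}
    {o o' : κ → ι} (hT : (T.submatrix o' id).det ∈ nonZeroDivisors R)
    (hK : l • T = K * T.submatrix o id) {x : ι → R} (hx : Matrix.vecMul x T = 0) :
    Matrix.vecMul x (l ^ Fintype.card κ • K) = 0 := by
  have h1 : Matrix.vecMul (Matrix.vecMul x K) (T.submatrix o id) = 0 := by
    rw [Matrix.vecMul_vecMul, ← hK, Matrix.vecMul_smul, hx, smul_zero]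
  have h2 : (T.submatrix o id).det • Matrix.vecMul x K = 0 := by
    have := congrArg (fun v => Matrix.vecMul v (T.submatrix o id).adjugate) h1
    simpa [Matrix.vecMul_vecMul, Matrix.mul_assoc, Matrix.mul_adjugate, Matrix.vecMul_smul]
      using this
  have h3 : l • T.submatrix o' id = K.submatrix o' id * T.submatrix o id :=
    congrArg (fun M : Matrix ι κ R => M.submatrix o' id) hK
  have h4 := congrArg Matrix.det h3
  rw [Matrix.det_smul, Matrix.det_mul] at h4
  -- Determinants in `h3` make `l^|κ| det T_{o'}` a multiple of `det T_o`, which kills `x K`; then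
  -- `det T_{o'}` cancels.
  have h5 : (T.submatrix o' id).det • (l ^ Fintype.card κ • Matrix.vecMul x K) = 0 := by
    rw [smul_smul, mul_comm, h4, ← smul_smul, h2, smul_zero]
  rw [Matrix.vecMul_smul]
  funext j
  exact (mem_nonZeroDivisors_iff.1 hT).1 _ (congrFun h5 j)

end Minors

/-! ### Common denominators and matrix fractions -/

section Denominators

variable {A F : Type*} [CommRing A] [CommRing F] [Algebra A F] {Z : Ideal A}

theorem mem_nonZeroDivisors_of_notMem (hZdiv : ∀ x : A, (∃ y : A, y ≠ 0 ∧ x * y = 0) → x ∈ Z)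
    {d : A} (hd : d ∉ Z) : d ∈ nonZeroDivisors A := by
  rw [mem_nonZeroDivisors_iff_right]
  intro x hx
  by_contra h
  exact hd (hZdiv d ⟨x, h, by rwa [mul_comm]⟩)

theorem IsCausal.exists_smul_eq_map {ι κ : Type*} [Fintype ι] [Fintype κ] (hZ : Z.IsPrime)
    {P : Matrix ι κ F} (hP : IsCausal Z P) :
    ∃ d ∉ Z, ∃ P₀ : Matrix ι κ A, algebraMap A F d • P = P₀.map (algebraMap A F) := by
  classical
  choose a d hd h using hP
  refine ⟨∏ p : ι × κ, d p.1 p.2, ?_,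
    Matrix.of fun i j => a i j * ∏ p ∈ Finset.univ.erase (i, j), d p.1 p.2, ?_⟩
  · intro hmem
    obtain ⟨p, -, hp⟩ := (hZ.prod_mem_iff).1 hmem
    exact hd _ _ hp
  · ext i j
    rw [← Finset.mul_prod_erase Finset.univ _ (Finset.mem_univ (i, j))]
    simp only [Matrix.smul_apply, Matrix.map_apply, Matrix.of_apply, map_mul, smul_eq_mul, ← h]
    ring

theorem exists_fractions [IsFractionRing A F] {n m : ℕ} {P : Matrix (Fin n) (Fin m) F} {d : A}
    (hd : d ∈ nonZeroDivisors A) {P₀ : Matrix (Fin n) (Fin m) A}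
    (h : algebraMap A F d • P = P₀.map (algebraMap A F)) :
    IsRightFraction P P₀ (d • 1) ∧ IsLeftFraction P P₀ (d • 1) := by
  have hmap : ∀ k : ℕ, (d • (1 : Matrix (Fin k) (Fin k) A)).map (algebraMap A F) =
      algebraMap A F d • 1 := by
    intro k
    ext i j
    by_cases hij : i = j <;> simp [hij]
  have hdet : ∀ k : ℕ, (d • (1 : Matrix (Fin k) (Fin k) A)).det ∈ nonZeroDivisors A := by
    intro k
    rw [Matrix.det_smul, Matrix.det_one, mul_one]
    exact pow_mem hd _
  have hu : IsUnit (algebraMap A F d) := IsLocalization.map_units F ⟨d, hd⟩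
  obtain ⟨u, hu⟩ := hu
  have hinv : ∀ k : ℕ, (algebraMap A F d • (1 : Matrix (Fin k) (Fin k) F))⁻¹ =
      (↑u⁻¹ : F) • 1 := by
    intro k
    refine Matrix.inv_eq_left_inv ?_
    rw [← hu, Matrix.smul_mul, Matrix.one_mul, smul_smul, Units.inv_mul, one_smul]
  constructor
  · refine ⟨hdet m, ?_⟩
    rw [hmap, hinv, ← h, ← hu, Matrix.mul_smul, Matrix.mul_one, smul_smul, Units.inv_mul, one_smul]
  · refine ⟨hdet n, ?_⟩
    rw [hmap, hinv, ← h, ← hu, Matrix.smul_mul, Matrix.one_mul, smul_smul, Units.inv_mul, one_smul]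

end Denominators

section Fractions

variable {A F : Type*} [CommRing A] [CommRing F] [Algebra A F] [IsFractionRing A F] {n m : ℕ}
  {P : Matrix (Fin n) (Fin m) F}

theorem map_algebraMap_injective (A F : Type*) [CommRing A] [CommRing F] [Algebra A F]
    [IsFractionRing A F] (ι κ : Type*) :
    Function.Injective fun M : Matrix ι κ A => M.map (algebraMap A F) :=
  Matrix.map_injective (IsFractionRing.injective A F)

theorem isUnit_det_map {k : ℕ} {D : Matrix (Fin k) (Fin k) A} (h : D.det ∈ nonZeroDivisors A) :
    IsUnit (D.map (algebraMap A F)).det := by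
  rw [← RingHom.mapMatrix_apply, ← RingHom.map_det]
  exact IsLocalization.map_units F ⟨_, h⟩

theorem IsRightFraction.mul_eq {N : Matrix (Fin n) (Fin m) A} {D : Matrix (Fin m) (Fin m) A}
    (h : IsRightFraction P N D) : P * D.map (algebraMap A F) = N.map (algebraMap A F) := by
  rw [h.2, Matrix.mul_assoc, Matrix.nonsing_inv_mul _ (isUnit_det_map h.1), Matrix.mul_one]

theorem IsLeftFraction.mul_eq {N' : Matrix (Fin n) (Fin m) A} {D' : Matrix (Fin n) (Fin n) A}
    (h : IsLeftFraction P N' D') : D'.map (algebraMap A F) * P = N'.map (algebraMap A F) := by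
  rw [h.2, ← Matrix.mul_assoc, Matrix.mul_nonsing_inv _ (isUnit_det_map h.1), Matrix.one_mul]

end Fractions

/-! ### From controllers to splittings -/

section Splitting

variable {F : Type*} [CommRing F] {n m : ℕ}

/-- There is a left inverse `[S₁ S₂]` over `A` of `[P; 1]` such that the idempotent
`[P; 1] [S₁ S₂] = [E₁₁ E₁₂; S₁ S₂]` has its entries in `A` as well. -/
def HasSplitting (A : Type*) [CommRing A] [Algebra A F] (P : Matrix (Fin n) (Fin m) F) : Prop :=
  ∃ (E₁₁ : Matrix (Fin n) (Fin n) A) (E₁₂ : Matrix (Fin n) (Fin m) A)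
    (S₁ : Matrix (Fin m) (Fin n) A) (S₂ : Matrix (Fin m) (Fin m) A),
    P * S₁.map (algebraMap A F) = E₁₁.map (algebraMap A F) ∧
    P * S₂.map (algebraMap A F) = E₁₂.map (algebraMap A F) ∧
    S₁.map (algebraMap A F) * P + S₂.map (algebraMap A F) = 1

variable {A : Type*} [CommRing A] [Algebra A F] {P : Matrix (Fin n) (Fin m) F}

theorem IsStabilizable.hasSplitting (h : IsStabilizable A P) : HasSplitting A P := by
  obtain ⟨C, hdet, hC⟩ := h
  choose H hH using hC
  have hdet' : IsUnit (1 + C * P).det := by rwa [Matrix.det_one_add_mul_comm]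
  have h11 : (Matrix.of fun i j => H (Sum.inl i) (Sum.inl j)).map (algebraMap A F) =
      (1 + P * C)⁻¹ := Matrix.ext fun i j => hH (Sum.inl i) (Sum.inl j)
  have h12 : (Matrix.of fun i j => H (Sum.inl i) (Sum.inr j)).map (algebraMap A F) =
      -(P * (1 + C * P)⁻¹) := Matrix.ext fun i j => hH (Sum.inl i) (Sum.inr j)
  have h21 : (Matrix.of fun i j => H (Sum.inr i) (Sum.inl j)).map (algebraMap A F) =
      C * (1 + P * C)⁻¹ := Matrix.ext fun i j => hH (Sum.inr i) (Sum.inl j)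
  have h22 : (Matrix.of fun i j => H (Sum.inr i) (Sum.inr j)).map (algebraMap A F) =
      (1 + C * P)⁻¹ := Matrix.ext fun i j => hH (Sum.inr i) (Sum.inr j)
  -- Push-through identity, from `(1 + C P) C = C (1 + P C)`.
  have hpush : C * (1 + P * C)⁻¹ = (1 + C * P)⁻¹ * C := by
    calc C * (1 + P * C)⁻¹
        = (1 + C * P)⁻¹ * ((1 + C * P) * C) * (1 + P * C)⁻¹ := by
          rw [← Matrix.mul_assoc, Matrix.nonsing_inv_mul _ hdet', Matrix.one_mul]
      _ = (1 + C * P)⁻¹ * C * ((1 + P * C) * (1 + P * C)⁻¹) := by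
          simp only [Matrix.add_mul, Matrix.mul_add, Matrix.one_mul, Matrix.mul_assoc]
      _ = (1 + C * P)⁻¹ * C := by
          rw [Matrix.mul_nonsing_inv _ hdet, Matrix.mul_one]
  refine ⟨1 - Matrix.of fun i j => H (Sum.inl i) (Sum.inl j),
    -Matrix.of fun i j => H (Sum.inl i) (Sum.inr j),
    Matrix.of fun i j => H (Sum.inr i) (Sum.inl j),
    Matrix.of fun i j => H (Sum.inr i) (Sum.inr j), ?_, ?_, ?_⟩
  · rw [h21, Matrix.map_sub _ (map_sub _), h11, Matrix.map_one _ (map_zero _) (map_one _),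
      eq_sub_iff_add_eq, ← Matrix.mul_assoc]
    nth_rewrite 2 [← Matrix.one_mul (1 + P * C)⁻¹]
    rw [← Matrix.add_mul, add_comm, Matrix.mul_nonsing_inv _ hdet]
  · rw [h22, Matrix.map_neg _ (map_neg _), h12, neg_neg]
  · rw [h21, h22, hpush, Matrix.mul_assoc]
    nth_rewrite 2 [← Matrix.mul_one (1 + C * P)⁻¹]
    rw [← Matrix.mul_add, add_comm (C * P), Matrix.nonsing_inv_mul _ hdet']

end Splitting

/-! ### Splittings and projectivity -/

section FractionSplitting

variable {A : Type*} (F : Type*) [CommRing A] [CommRing F] [Algebra A F]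

/-- Over `F` the matrix `T` is, up to an invertible factor `U` on the right, a matrix `M` having a
left inverse `S` such that the idempotent `M S` has its entries in `A`. -/
def HasFractionSplitting {ι κ : Type*} [Fintype κ] [Fintype ι] [DecidableEq κ]
    (T : Matrix ι κ A) : Prop :=
  ∃ (M : Matrix ι κ F) (S : Matrix κ ι F) (U : Matrix κ κ F) (G : Matrix ι ι A),
    IsUnit U.det ∧ T.map (algebraMap A F) = M * U ∧ S * M = 1 ∧ G.map (algebraMap A F) = M * S

variable {F}

section General

variable {ι κ : Type*} [Fintype κ] [Fintype ι] [DecidableEq κ] {T : Matrix ι κ A}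

theorem HasFractionSplitting.submatrix_equiv {ι' : Type*} [Fintype ι']
    (h : HasFractionSplitting F T) (e : ι' ≃ ι) : HasFractionSplitting F (T.submatrix e id) := by
  obtain ⟨M, S, U, G, hU, hT, hSM, hG⟩ := h
  refine ⟨M.submatrix e id, S.submatrix id e, U, G.submatrix e e, hU, ?_, ?_, ?_⟩
  · rw [← Matrix.submatrix_map, hT]
    rfl
  · rw [Matrix.submatrix_mul_equiv, hSM]
    rfl
  · rw [← Matrix.submatrix_map, hG]
    rfl

/-- Over `F`, `G T = M S M U = M U = T`, and `x T = 0` forces `x M = 0` because `U` is invertible.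
-/
theorem HasFractionSplitting.projective_rowModule [IsFractionRing A F]
    (h : HasFractionSplitting F T) : Module.Projective A (rowModule T) := by
  classical
  obtain ⟨M, S, U, G, hU, hT, hSM, hG⟩ := h
  rw [projective_rowModule_iff]
  refine ⟨G, ?_, fun x hx => ?_⟩
  · apply map_algebraMap_injective A F
    simp only [Matrix.map_mul, hG, hT]
    rw [Matrix.mul_assoc, ← Matrix.mul_assoc S, hSM, Matrix.one_mul]
  · have h1 : Matrix.vecMul (algebraMap A F ∘ x) (M * U) = 0 := by
      funext j
      rw [← hT, ← RingHom.map_vecMul, hx]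
      simp
    have h2 : Matrix.vecMul (algebraMap A F ∘ x) M = 0 := by
      have := congrArg (fun v => Matrix.vecMul v U⁻¹) h1
      simpa [Matrix.vecMul_vecMul, Matrix.mul_assoc, Matrix.mul_nonsing_inv _ hU] using this
    funext j
    apply IsFractionRing.injective A F
    rw [RingHom.map_vecMul, hG, ← Matrix.vecMul_vecMul, h2]
    simp

end General

variable [IsFractionRing A F] {n m : ℕ} {P : Matrix (Fin n) (Fin m) F}
  {N : Matrix (Fin n) (Fin m) A} {D : Matrix (Fin m) (Fin m) A}
  {N' : Matrix (Fin n) (Fin m) A} {D' : Matrix (Fin n) (Fin n) A}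

theorem HasSplitting.fromRows (h : HasSplitting A P) (hR : IsRightFraction P N D) :
    HasFractionSplitting F (Matrix.fromRows N D) := by
  obtain ⟨E₁₁, E₁₂, S₁, S₂, h₁, h₂, h₃⟩ := h
  refine ⟨Matrix.fromRows P 1,
    Matrix.fromCols (S₁.map (algebraMap A F)) (S₂.map (algebraMap A F)), D.map (algebraMap A F),
    Matrix.fromBlocks E₁₁ E₁₂ S₁ S₂, isUnit_det_map hR.1, ?_, ?_, ?_⟩
  · rw [Matrix.fromRows_mul, hR.mul_eq, Matrix.one_mul, Matrix.fromRows_map]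
  · rw [Matrix.fromCols_mul_fromRows, Matrix.mul_one, h₃]
  · rw [Matrix.fromRows_mul_fromCols, h₁, h₂, Matrix.one_mul, Matrix.one_mul, Matrix.fromBlocks_map]

/-- Here `[N' D'] = D' [P 1]`, and `[S₁; 1 - E₁₁]` is a right inverse of `[P 1]`. The idempotent it
gives is, up to block order and signs, the complement of `[P; 1] [S₁ S₂]`. -/
theorem HasSplitting.fromCols_transpose (h : HasSplitting A P) (hL : IsLeftFraction P N' D') :
    HasFractionSplitting F (Matrix.fromCols N' D').transpose := by
  obtain ⟨E₁₁, E₁₂, S₁, S₂, h₁, h₂, h₃⟩ := h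
  have h₄ : S₁.map (algebraMap A F) * P = 1 - S₂.map (algebraMap A F) := eq_sub_of_add_eq h₃
  refine ⟨(Matrix.fromCols P 1).transpose,
    (Matrix.fromRows (S₁.map (algebraMap A F)) (1 - E₁₁.map (algebraMap A F))).transpose,
    (D'.map (algebraMap A F)).transpose,
    (Matrix.fromBlocks (1 - S₂) S₁ E₁₂ (1 - E₁₁)).transpose, ?_, ?_, ?_, ?_⟩
  · rw [Matrix.det_transpose]
    exact isUnit_det_map hL.1
  · rw [← Matrix.transpose_mul, Matrix.mul_fromCols, hL.mul_eq, Matrix.mul_one,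
      Matrix.transpose_map, Matrix.fromCols_map]
  · rw [← Matrix.transpose_mul, Matrix.fromCols_mul_fromRows, h₁, Matrix.one_mul,
      add_sub_cancel, Matrix.transpose_one]
  · rw [← Matrix.transpose_mul, Matrix.transpose_map, Matrix.fromRows_mul_fromCols, h₄,
      Matrix.sub_mul, ← h₁, Matrix.mul_assoc, h₄, Matrix.mul_sub, h₂, Matrix.mul_one, Matrix.mul_one,
      Matrix.one_mul, Matrix.mul_one, sub_sub_cancel, Matrix.fromBlocks_map,
      Matrix.map_sub _ (map_sub _), Matrix.map_sub _ (map_sub _),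
      Matrix.map_one _ (map_zero _) (map_one _), Matrix.map_one _ (map_zero _) (map_one _), h₁]

/-- The rows of `[D' -N']` are relations between the rows of `T`, so they kill `G`; hence the upper
blocks of `G` are `P` times the lower ones. The lower half of `G T = T`, multiplied by `D⁻¹`, is the
remaining equation. -/
theorem hasSplitting_of_projective (hR : IsRightFraction P N D) (hL : IsLeftFraction P N' D')
    (h : Module.Projective A (rowModule (Matrix.fromRows N D))) : HasSplitting A P := by
  obtain ⟨G, hG, hker⟩ := (projective_rowModule_iff _).1 h
  have hleft : D' * N = N' * D := by
    apply map_algebraMap_injective A F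
    simp only [Matrix.map_mul]
    rw [← hR.mul_eq, ← hL.mul_eq, Matrix.mul_assoc]
  have hzero : Matrix.fromCols D' (-N') * G = 0 := by
    refine Matrix.ext_of_single_vecMul fun i => ?_
    rw [← Matrix.vecMul_vecMul, Matrix.vecMul_zero]
    apply hker
    rw [Matrix.vecMul_vecMul, Matrix.fromCols_mul_fromRows, hleft, Matrix.neg_mul, add_neg_cancel,
      Matrix.vecMul_zero]
  rw [← Matrix.fromBlocks_toBlocks G] at hG hzero
  rw [Matrix.fromBlocks_mul_fromRows, Matrix.fromRows_ext_iff] at hG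
  rw [Matrix.fromCols_mul_fromBlocks, ← Matrix.fromCols_zero, Matrix.fromCols_ext_iff] at hzero
  have hD := isUnit_det_map (F := F) hR.1
  have key : ∀ {k : ℕ} (X : Matrix (Fin n) (Fin k) A) (Y : Matrix (Fin m) (Fin k) A),
      D' * X + -N' * Y = 0 → P * Y.map (algebraMap A F) = X.map (algebraMap A F) := by
    intro k X Y hXY
    have hXY' : D' * X = N' * Y := by rwa [Matrix.neg_mul, add_neg_eq_zero] at hXY
    rw [hL.2, Matrix.mul_assoc, ← Matrix.map_mul, ← hXY', Matrix.map_mul, ← Matrix.mul_assoc,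
      Matrix.nonsing_inv_mul _ (isUnit_det_map hL.1), Matrix.one_mul]
  refine ⟨G.toBlocks₁₁, G.toBlocks₁₂, G.toBlocks₂₁, G.toBlocks₂₂, key _ _ hzero.1,
    key _ _ hzero.2, ?_⟩
  have h1 := congrArg (fun M => M.map (algebraMap A F)) hG.2
  simp only [Matrix.map_add _ (map_add _), Matrix.map_mul, ← hR.mul_eq] at h1
  rw [← Matrix.mul_assoc, ← Matrix.add_mul] at h1
  have h2 := congrArg (fun M => M * (D.map (algebraMap A F))⁻¹) h1
  simpa only [Matrix.mul_assoc, Matrix.mul_nonsing_inv _ hD, Matrix.mul_one] using h2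

end FractionSplitting

/-! ### Generalized elementary factors -/

section GeneralizedElementaryFactors

variable {A : Type*} [CommRing A]

/-- The `l ∈ A` such that multiplication by `l` on the row module of `T` factors through the free
module on the rows of `T`. -/
def splittingIdeal {ι κ : Type*} [Fintype ι] (T : Matrix ι κ A) : Ideal A where
  carrier := {l | ∃ G : Matrix ι ι A, l • T = G * T ∧
    ∀ x, Matrix.vecMul x T = 0 → Matrix.vecMul x G = 0}
  zero_mem' := ⟨0, by simp, by simp⟩
  add_mem' := by
    rintro a b ⟨G, hG, hG'⟩ ⟨H, hH, hH'⟩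
    exact ⟨G + H, by rw [add_smul, hG, hH, Matrix.add_mul],
      fun x hx => by rw [Matrix.vecMul_add, hG' x hx, hH' x hx, add_zero]⟩
  smul_mem' := by
    rintro c a ⟨G, hG, hG'⟩
    exact ⟨c • G, by rw [smul_eq_mul, mul_smul, hG, Matrix.smul_mul],
      fun x hx => by rw [Matrix.vecMul_smul, hG' x hx, smul_zero]⟩

theorem projective_rowModule_of_splittingIdeal_eq_top {ι κ : Type*} [Fintype ι]
    {T : Matrix ι κ A} (h : splittingIdeal T = ⊤) : Module.Projective A (rowModule T) := by
  classical
  obtain ⟨G, hG, hker⟩ := (Ideal.eq_top_iff_one _).1 h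
  exact (projective_rowModule_iff T).2 ⟨G, by rw [← hG, one_smul], hker⟩

theorem selectionMatrix_mul {n m : ℕ} {κ : Type*} (I : Finset (Fin (n + m))) (hI : I.card = m)
    (T : Matrix (Fin (n + m)) κ A) :
    selectionMatrix A I hI * T = T.submatrix (I.orderEmbOfFin hI) id := by
  ext k j
  simp [selectionMatrix, Matrix.mul_apply]

theorem rowStack_submatrix_natAdd {R : Type*} {n m : ℕ} (N : Matrix (Fin n) (Fin m) R)
    (D : Matrix (Fin m) (Fin m) R) : (rowStack N D).submatrix (Fin.natAdd n) id = D := by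
  ext i j
  simp [rowStack]

variable {n m : ℕ} {N : Matrix (Fin n) (Fin m) A} {D : Matrix (Fin m) (Fin m) A}

/-- The matrix `K Δ_I` need not respect the relations between the rows of `T`, but `l^m K Δ_I` does;
with the `l` already present this gives exponent `m + 1`. -/
theorem generalizedElementaryFactor_le_radical_splittingIdeal (hD : D.det ∈ nonZeroDivisors A)
    (I : Finset (Fin (n + m))) (hI : I.card = m) :
    generalizedElementaryFactor N D I hI ≤ (splittingIdeal (rowStack N D)).radical := by
  rintro l ⟨K, hK⟩
  rw [← rowStack_submatrix_natAdd N D] at hD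
  refine ⟨m + 1, l ^ m • K * selectionMatrix A I hI, ?_, fun x hx => ?_⟩
  · rw [pow_succ, mul_smul, hK, Matrix.smul_mul, Matrix.smul_mul]
  · rw [Matrix.mul_assoc, selectionMatrix_mul] at hK
    have := pow_smul_vecMul_eq_zero hD hK hx
    rw [Fintype.card_fin] at this
    rw [← Matrix.vecMul_vecMul, this, Matrix.zero_vecMul]

theorem projective_rowModule_of_iSup_eq_top (hD : D.det ∈ nonZeroDivisors A)
    (h : (⨆ I : {I : Finset (Fin (n + m)) // I.card = m},
      generalizedElementaryFactor N D I.1 I.2) = ⊤) :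
    Module.Projective A (rowModule (rowStack N D)) := by
  apply projective_rowModule_of_splittingIdeal_eq_top
  rw [← Ideal.radical_eq_top, eq_top_iff, ← h]
  exact iSup_le fun I => generalizedElementaryFactor_le_radical_splittingIdeal hD I.1 I.2

theorem iSup_generalizedElementaryFactor_eq_top {F : Type*} [CommRing F] [Algebra A F]
    [IsFractionRing A F] (h : HasFractionSplitting F (rowStack N D)) :
    (⨆ I : {I : Finset (Fin (n + m)) // I.card = m},
      generalizedElementaryFactor N D I.1 I.2) = ⊤ := by
  obtain ⟨M, S, U, G, hU, hT, hSM, hG⟩ := h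
  have hsum : ∑ s ∈ Finset.univ.powersetCard m,
      (G.submatrix (Subtype.val : s → Fin (n + m)) (Subtype.val : s → Fin (n + m))).det = 1 := by
    apply IsFractionRing.injective A F
    have := sum_minors_eq_one M S hSM
    rw [Fintype.card_fin, ← hG] at this
    rw [map_sum, map_one, ← this]
    refine Finset.sum_congr rfl fun s _ => ?_
    rw [RingHom.map_det]
    rfl
  rw [Ideal.eq_top_iff_one, ← hsum]
  refine Ideal.sum_mem _ fun I hI => ?_
  have hcard : I.card = m := (Finset.mem_powersetCard.1 hI).2
  refine (le_iSup (fun I : {I : Finset (Fin (n + m)) // I.card = m} =>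
    generalizedElementaryFactor N D I.1 I.2) ⟨I, hcard⟩) ?_
  set o := I.orderEmbOfFin hcard
  have hdet : (G.submatrix (Subtype.val : I → Fin (n + m)) (Subtype.val : I → Fin (n + m))).det =
      (G.submatrix o o).det :=
    (Matrix.det_submatrix_equiv_self (I.orderIsoOfFin hcard).toEquiv
      (G.submatrix (Subtype.val : I → Fin (n + m)) (Subtype.val : I → Fin (n + m)))).symm
  refine ⟨G.submatrix id o * (G.submatrix o o).adjugate, ?_⟩
  rw [hdet, Matrix.mul_assoc, show selectionMatrix A I _ * rowStack N D =
    (rowStack N D).submatrix o id from selectionMatrix_mul I hcard _]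
  apply map_algebraMap_injective A F
  have hadj : (G.submatrix o o).adjugate.map (algebraMap A F) =
      ((M * S).submatrix o o).adjugate := by
    rw [← hG]
    exact RingHom.map_adjugate (algebraMap A F) (G.submatrix o o)
  have hdet' : algebraMap A F (G.submatrix o o).det = ((M * S).submatrix o o).det := by
    rw [← hG]
    exact RingHom.map_det (algebraMap A F) (G.submatrix o o)
  have hsub : ((rowStack N D).submatrix o id).map (algebraMap A F) = M.submatrix o id * U := by
    rw [← Matrix.submatrix_map, hT]
    rfl
  have hcol : (G.submatrix id o).map (algebraMap A F) = (M * S).submatrix id o := by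
    rw [← hG]
    rfl
  simp only [Matrix.map_mul, hadj, hsub, hcol]
  rw [← Matrix.mul_assoc, mul_submatrix_mul_adjugate_mul_submatrix, ← hdet', Matrix.smul_mul, ← hT]
  ext i j
  simp

end GeneralizedElementaryFactors

/-! ### From splittings to controllers -/

section Stabilization

/-- If `S` and `P` have no common kernel, `S + c X P` is injective for a suitable `X` and every
`c ≠ 0`. -/
theorem exists_injective_add_smul_comp {k V W : Type*} [Field k] [AddCommGroup V] [Module k V]
    [FiniteDimensional k V] [AddCommGroup W] [Module k W] (S : V →ₗ[k] V) (P : V →ₗ[k] W)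
    (h : ∀ v, S v = 0 → P v = 0 → v = 0) :
    ∃ X : W →ₗ[k] V, ∀ c : k, c ≠ 0 → ∀ v, S v + c • X (P v) = 0 → v = 0 := by
  obtain ⟨Q, hQ⟩ := (LinearMap.range S).exists_isCompl
  have hdim : Module.finrank k (LinearMap.ker S) = Module.finrank k Q := by
    have h1 := S.finrank_range_add_finrank_ker
    have h2 := Submodule.finrank_add_eq_of_isCompl hQ
    omega
  let e : LinearMap.ker S ≃ₗ[k] Q := LinearEquiv.ofFinrankEq _ _ hdim
  obtain ⟨g, hg⟩ := (P ∘ₗ (LinearMap.ker S).subtype).exists_leftInverse_of_injective (by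
    rw [LinearMap.ker_eq_bot']
    exact fun v hv => Subtype.ext (h v v.2 hv))
  -- `X` recovers `ker S` from its image under `P` and carries it onto a complement of `range S`, so
  -- the two summands cannot cancel.
  refine ⟨Q.subtype ∘ₗ e.toLinearMap ∘ₗ g, fun c hc v hv => ?_⟩
  have hmem : S v ∈ Q := by
    rw [eq_neg_of_add_eq_zero_left hv]
    exact Q.neg_mem (Q.smul_mem _ (e (g (P v))).2)
  have hSv : S v = 0 := (Submodule.disjoint_def.1 hQ.disjoint) _ ⟨v, rfl⟩ hmem
  rw [hSv, zero_add] at hv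
  have hgv : g (P v) = ⟨v, hSv⟩ := LinearMap.congr_fun hg ⟨v, hSv⟩
  have h0 : e (g (P v)) = 0 := Subtype.ext ((smul_eq_zero.1 hv).resolve_left hc)
  rw [hgv, e.map_eq_zero_iff] at h0
  exact congrArg Subtype.val h0

/-- Modulo `Z`, over the fraction field of `A / Z`, `d` is invertible, so `S₂` and `P` have no
common kernel and the preceding linear algebra applies. -/
theorem exists_det_add_smul_mul_notMem {A : Type*} [CommRing A] {Z : Ideal A} (hZ : Z.IsPrime)
    {n m : ℕ} {d : A} (hd : d ∉ Z) {P : Matrix (Fin n) (Fin m) A} {S₁ : Matrix (Fin m) (Fin n) A}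
    {S₂ : Matrix (Fin m) (Fin m) A} (h : S₁ * P + d • S₂ = d • 1) :
    ∃ X : Matrix (Fin m) (Fin n) A, (S₂ + d • (X * P)).det ∉ Z := by
  let k := FractionRing (A ⧸ Z)
  let f : A →+* k := (algebraMap (A ⧸ Z) k).comp (Ideal.Quotient.mk Z)
  have hf : ∀ a, f a = 0 ↔ a ∈ Z := fun a => by
    rw [RingHom.comp_apply, map_eq_zero_iff _ (IsFractionRing.injective (A ⧸ Z) k),
      Ideal.Quotient.eq_zero_iff_mem]
  have hfd : f d ≠ 0 := fun h0 => hd ((hf d).1 h0)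
  have hsmul : ∀ {p q : ℕ} (a : A) (M : Matrix (Fin p) (Fin q) A),
      (a • M).map f = f a • M.map f := by
    intro p q a M
    ext i j
    simp
  have hk : (S₁.map f) * (P.map f) + f d • S₂.map f = f d • 1 := by
    have := congrArg (fun M => M.map f) h
    simpa only [Matrix.map_add _ (map_add f), Matrix.map_mul, hsmul,
      Matrix.map_one f (map_zero f) (map_one f)] using this
  obtain ⟨X, hX⟩ := exists_injective_add_smul_comp (Matrix.toLin' (S₂.map f))
    (Matrix.toLin' (P.map f)) (by
      intro v h1 h2
      rw [Matrix.toLin'_apply] at h1 h2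
      have := congrArg (fun M => Matrix.mulVec M v) hk
      simp only [Matrix.add_mulVec, Matrix.smul_mulVec, ← Matrix.mulVec_mulVec, h1, h2,
        Matrix.mulVec_zero, Matrix.one_mulVec, smul_zero, add_zero] at this
      exact (smul_eq_zero.1 this.symm).resolve_left hfd)
  -- Lifting `X` to `A` requires a common denominator; it is absorbed by the freedom in the nonzero
  -- scalar.
  obtain ⟨b, hb⟩ := IsLocalization.exist_integer_multiples_of_finite (nonZeroDivisors (A ⧸ Z))
    (fun p : Fin m × Fin n => LinearMap.toMatrix' X p.1 p.2)
  choose y hy using hb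
  choose x hx using fun p => Ideal.Quotient.mk_surjective (y p)
  obtain ⟨c, hc⟩ := Ideal.Quotient.mk_surjective (b : A ⧸ Z)
  have hfc : f c ≠ 0 := by
    rw [RingHom.comp_apply, hc]
    exact IsFractionRing.to_map_ne_zero_of_mem_nonZeroDivisors b.2
  refine ⟨Matrix.of fun i j => x (i, j), fun hmem => ?_⟩
  have hXm : (Matrix.of fun i j => x (i, j)).map f = f c • LinearMap.toMatrix' X := by
    ext i j
    have := hy (i, j)
    simp only [Matrix.map_apply, Matrix.of_apply, Matrix.smul_apply, f, RingHom.comp_apply, hx, hc,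
      this, Algebra.smul_def]
    simp
  rw [← hf, RingHom.map_det, RingHom.mapMatrix_apply, Matrix.map_add _ (map_add f), hsmul,
    Matrix.map_mul, hXm] at hmem
  obtain ⟨v, hv0, hv⟩ := Matrix.exists_mulVec_eq_zero_iff.2 hmem
  refine hv0 (hX (f d * f c) (mul_ne_zero hfd hfc) v ?_)
  rw [Matrix.toLin'_apply, Matrix.toLin'_apply, ← LinearMap.toMatrix'_mulVec X]
  rw [Matrix.smul_mul, smul_smul, Matrix.add_mulVec, Matrix.smul_mulVec,
    ← Matrix.mulVec_mulVec] at hv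
  exact hv

/-- A splitting `[S₁ S₂]` with `S₂` invertible over `F` gives the controller `S₂⁻¹ S₁`. -/
theorem isStabilizable_of_isUnit_det {A F : Type*} [CommRing A] [CommRing F] [Algebra A F]
    {n m : ℕ} {P : Matrix (Fin n) (Fin m) F}
    {E₁₁ : Matrix (Fin n) (Fin n) A} {E₁₂ : Matrix (Fin n) (Fin m) A}
    {S₁ : Matrix (Fin m) (Fin n) A} {S₂ : Matrix (Fin m) (Fin m) A}
    (h₁ : P * S₁.map (algebraMap A F) = E₁₁.map (algebraMap A F))
    (h₂ : P * S₂.map (algebraMap A F) = E₁₂.map (algebraMap A F))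
    (h₃ : S₁.map (algebraMap A F) * P + S₂.map (algebraMap A F) = 1)
    (hu : IsUnit (S₂.map (algebraMap A F)).det) : IsStabilizable A P := by
  set R₁ := S₁.map (algebraMap A F) with hR₁
  set R₂ := S₂.map (algebraMap A F) with hR₂
  have hCP : R₂⁻¹ * (R₁ * P) + 1 = R₂⁻¹ := by
    rw [eq_sub_of_add_eq h₃, Matrix.mul_sub, Matrix.nonsing_inv_mul _ hu, Matrix.mul_one,
      sub_add_cancel]
  have hinv : (1 + R₂⁻¹ * R₁ * P)⁻¹ = R₂ := by
    rw [Matrix.mul_assoc, add_comm, hCP, Matrix.nonsing_inv_nonsing_inv _ hu]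
  have hdet : IsUnit (1 + P * (R₂⁻¹ * R₁)).det := by
    rw [Matrix.det_one_add_mul_comm, Matrix.mul_assoc, add_comm, hCP]
    exact Matrix.isUnit_nonsing_inv_det _ hu
  have hcomm : R₁ * (1 - P * R₁) = R₂ * R₁ := by
    rw [Matrix.mul_sub, Matrix.mul_one, ← Matrix.mul_assoc, eq_sub_of_add_eq h₃, Matrix.sub_mul,
      Matrix.one_mul, sub_sub_cancel]
  have hC : R₂⁻¹ * R₁ * (1 - P * R₁) = R₁ := by
    rw [Matrix.mul_assoc, hcomm, ← Matrix.mul_assoc, Matrix.nonsing_inv_mul _ hu, Matrix.one_mul]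
  have hinv' : (1 + P * (R₂⁻¹ * R₁))⁻¹ = 1 - P * R₁ := by
    refine Matrix.inv_eq_right_inv ?_
    rw [Matrix.add_mul, Matrix.one_mul, Matrix.mul_assoc P, hC, sub_add_cancel]
  refine ⟨R₂⁻¹ * R₁, hdet, ?_⟩
  have hH : feedbackMatrix P (R₂⁻¹ * R₁) =
      (Matrix.fromBlocks (1 - E₁₁) (-E₁₂) S₁ S₂).map (algebraMap A F) := by
    rw [feedbackMatrix, hinv, hinv', hC, h₁, h₂, Matrix.fromBlocks_map,
      Matrix.map_sub _ (map_sub _), Matrix.map_neg _ (map_neg _),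
      Matrix.map_one _ (map_zero _) (map_one _)]
  intro i j
  rw [hH]
  exact ⟨_, rfl⟩

theorem HasSplitting.isStabilizable {A F : Type*} [CommRing A] [CommRing F] [Algebra A F]
    [IsFractionRing A F] {Z : Ideal A} (hZ : Z.IsPrime)
    (hZdiv : ∀ x : A, (∃ y : A, y ≠ 0 ∧ x * y = 0) → x ∈ Z)
    {n m : ℕ} {P : Matrix (Fin n) (Fin m) F} (hP : IsCausal Z P) (h : HasSplitting A P) :
    IsStabilizable A P := by
  obtain ⟨d, hd, P₀, hP₀⟩ := hP.exists_smul_eq_map hZ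
  obtain ⟨E₁₁, E₁₂, S₁, S₂, h₁, h₂, h₃⟩ := h
  have hsmul : ∀ {p q : ℕ} (a : A) (M : Matrix (Fin p) (Fin q) A),
      (a • M).map (algebraMap A F) = algebraMap A F a • M.map (algebraMap A F) := by
    intro p q a M
    ext i j
    simp
  obtain ⟨X, hX⟩ := exists_det_add_smul_mul_notMem hZ hd (P := P₀) (S₁ := S₁) (S₂ := S₂) (by
    apply map_algebraMap_injective A F
    simp only [Matrix.map_add _ (map_add _), Matrix.map_mul, hsmul, ← hP₀,
      Matrix.map_one _ (map_zero (algebraMap A F)) (map_one _)]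
    rw [Matrix.mul_smul, ← smul_add, h₃])
  -- Adding `d X [-d P₀]` keeps a left inverse since `[-d P₀] [P; 1] = 0`; the outer `d` keeps the
  -- products with `P` over `A`, as `d P = P₀`.
  refine isStabilizable_of_isUnit_det (E₁₁ := E₁₁ - d • (P₀ * X)) (E₁₂ := E₁₂ + P₀ * X * P₀)
    (S₁ := S₁ - (d * d) • X) (S₂ := S₂ + d • (X * P₀)) ?_ ?_ ?_
    (isUnit_det_map (mem_nonZeroDivisors_of_notMem hZdiv hX))
  · simp only [Matrix.map_sub _ (map_sub _), Matrix.map_mul, hsmul, ← hP₀, Matrix.mul_sub, h₁,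
      Matrix.mul_smul, Matrix.smul_mul, smul_smul, map_mul]
  · simp only [Matrix.map_add _ (map_add _), Matrix.map_mul, hsmul, ← hP₀, Matrix.mul_add, h₂,
      Matrix.mul_smul, Matrix.smul_mul, smul_smul, Matrix.mul_assoc]
  · simp only [Matrix.map_sub _ (map_sub _), Matrix.map_add _ (map_add _), Matrix.map_mul, hsmul,
      ← hP₀, Matrix.sub_mul, Matrix.mul_smul, Matrix.smul_mul, smul_smul, map_mul]
    rw [← h₃]
    abel

end Stabilization

end FeedbackStabilization

/-! ### The equivalence -/

open FeedbackStabilization in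
theorem theorem3p3 {A F : Type*} [CommRing A] [CommRing F] [Algebra A F] [IsFractionRing A F]
    (Z : Ideal A) (hZ : Z.IsPrime) (hZdiv : ∀ x : A, (∃ y : A, y ≠ 0 ∧ x * y = 0) → x ∈ Z)
    {n m : ℕ} (P : Matrix (Fin n) (Fin m) F) (hP : IsCausal Z P) :
    (∃ (N : Matrix (Fin n) (Fin m) A) (D : Matrix (Fin m) (Fin m) A)
        (N' : Matrix (Fin n) (Fin m) A) (D' : Matrix (Fin n) (Fin n) A),
        IsRightFraction P N D ∧ IsLeftFraction P N' D') ∧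
    ∀ (N : Matrix (Fin n) (Fin m) A) (D : Matrix (Fin m) (Fin m) A)
      (N' : Matrix (Fin n) (Fin m) A) (D' : Matrix (Fin n) (Fin n) A),
      IsRightFraction P N D → IsLeftFraction P N' D' →
      List.TFAE
        [IsStabilizable A P,
         Module.Projective A (rowModule (rowStack N D)) ∧
           Module.Projective A (colModule (Matrix.fromCols N' D')),
         (⨆ I : {I : Finset (Fin (n + m)) // I.card = m},
           generalizedElementaryFactor N D I.1 I.2) = (⊤ : Ideal A)] := by
  constructor
  · obtain ⟨d, hd, P₀, hP₀⟩ := hP.exists_smul_eq_map hZ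
    exact ⟨P₀, d • 1, P₀, d • 1, exists_fractions (mem_nonZeroDivisors_of_notMem hZdiv hd) hP₀⟩
  · intro N D N' D' hR hL
    have hstab : Module.Projective A (rowModule (rowStack N D)) → IsStabilizable A P := by
      intro h
      rw [rowStack, rowModule_submatrix_equiv] at h
      exact (hasSplitting_of_projective hR hL h).isStabilizable hZ hZdiv hP
    have hsplit : IsStabilizable A P → HasFractionSplitting F (rowStack N D) := fun h =>
      (h.hasSplitting.fromRows hR).submatrix_equiv finSumFinEquiv.symm
    tfae_have 1 → 2 := fun h => ⟨(hsplit h).projective_rowModule,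
      -- The column module is by definition the row module of the transpose.
      (h.hasSplitting.fromCols_transpose hL).projective_rowModule⟩
    tfae_have 2 → 1 := fun h => hstab h.1
    tfae_have 1 → 3 := fun h => iSup_generalizedElementaryFactor_eq_top (hsplit h)
    tfae_have 3 → 1 := fun h => hstab (projective_rowModule_of_iSup_eq_top hR.1 h)
    tfae_finish
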